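/- **Setting.** A target $X^*\in\mathbb R^d$, $d\ge 1$, is queried in rounds $n=0,\dots,N-1$ by a controller with $M$ players. Let $p_n$ be the posterior density of $X^*$ at time $n$, and $P_n(R)=\int_R p_n$. Densities are assumed to have finite differential entropy $H(p)=-\int p\log p$. At time $n$ the controller chooses, as a function of the history $\mathcal F_n$ of past queries and responses, a tuple $\mathbf A_n=(A_n^{(1)},\dots,A_n^{(M)})$ of regions, $A_n^{(m)}$ belonging to a given nonempty class $\mathcal Q_n^{(m)}$ of measurable subsets of $\mathbb R^d$. It receives binary responses $\mathbf Y_{n+1}=(Y^{(1)}_{n+1},\dots,Y^{(M)}_{n+1})\in\{0,1\}^M$ that are conditionally independent given $X^*$: $$\mathbb P(\mathbf Y_{n+1}=\mathbf y\mid \mathbf A_n,X^*=x,\mathcal F_n)=\prod_{m=1}^M f^{(m)}_{I(x\in A_n^{(m)})}(y^{(m)}\mid A_n^{(m)},\mathcal F_n),$$ where the $f^{(m)}_j(\cdot\mid A,\mathcal F_n)$, $j\in\{0,1\}$, are known probability mass functions on $\{0,1\}$. Then $p_{n+1}$ is obtained from $p_n$ by Bayes' rule. Put $A^1=A$, $A^0=A^c$,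 $g_{i_1:i_M}(\mathbf y)=\prod_m f^{(m)}_{i_m}(y^{(m)}\mid A^{(m)},\mathcal F_n)$, and $$\phi_n(\mathbf A)=H\Big(\sum_{i\in\{0,1\}^M} g_{i}\,P_n\big(\textstyle\bigcap_m (A^{(m)})^{i_m}\big)\Big)-\sum_{i\in\{0,1\}^M}H(g_{i})\,P_n\big(\textstyle\bigcap_m (A^{(m)})^{i_m}\big),\qquad G_n^*=\sup_{\mathbf A}\phi_n(\mathbf A),$$ where $H$ of a probability mass function is its Shannon entropy and the supremum is over the admissible query tuples. For a policy $\zeta$ let $\mathbb E^\zeta$ be the expectation under the law that it induces, and let $V_n(p)=\inf_\zeta\mathbb E^\zeta[H(p_N)\mid p_n=p,\mathcal F_n]$ for $0\le n\le N$. **Theorem.** 1. For every history, posterior $p_n$ and admissible query tuple $\mathbf A$, $H(p_n)-\mathbb E[H(p_{n+1})\mid\mathbf A_n=\mathbf A,\mathcal F_n]=\phi_n(\mathbf A)$; consequently $\sup_{\mathbf A}\{H(p_n)-\mathbb E[H(p_{n+1})\mid\mathbf A_n=\mathbf A,\mathcal F_n]\}=G_n^*$, which is finite. 2. Let $n\le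 N$ and $p_n=p$, and suppose that $G^*_k$ equals one and the same number $G^*$ for all $k\in\{n,\dots,N-1\}$ and all situations (histories, with their posteriors) that can arise at time $k$ with positive probability under some policy. Then the infimum defining $V_n(p)$ is finite, $$V_n(p)=H(p)-(N-n)G^*,$$ and a policy is optimal (attains this infimum) if and only if it is greedy, i.e. at each step $k=n,\dots,N-1$, in every situation that arises under it with positive probability, its queries satisfy $\phi_k(\mathbf A_k)=G^*$; so at each such step it achieves the expected entropy loss $G^*$. 3. Suppose that the channels are memoryless and time-invariant, $f^{(m)}_j(y\mid A,\mathcal F_n)=f^{(m)}_j(y)$, and that every measurable set is an admissible query region. Then $G_n^*$ is a constant $G^*$ that depends neither on $n$, nor on the history, nor on the posterior, and the supremum that defines it is attained. Hence all conclusions of part 2 hold for all $n\le N$ and all $p$, and an optimal policy exists. -/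

import Mathlib

open MeasureTheory

noncomputable section

namespace TwentyQuestions

/-- The space `ℝ^d` in which the target lives. -/
abbrev Loc (d : ℕ) : Type := EuclideanSpace ℝ (Fin d)

/-- A batch of query regions `(A⁽¹⁾, …, A⁽ᴹ⁾)`, one for each player. -/
abbrev Queries (d M : ℕ) : Type := Fin M → Set (Loc d)

/-- The binary responses of the `M` players in one round. -/
abbrev Responses (M : ℕ) : Type := Fin M → Bool

/-- The information available to the controller after `n` rounds: the list, in chronological order,
of the `n` batches of queries asked and of the responses to them. Its length is the time `n`. -/
abbrev History (d M : ℕ) : Type := List (Queries d M × Responses M)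

/-- The players' conditional response probabilities: `f h m A j y` is the probability that
player `m` answers `y`, when the history is `h`, the player is asked the region `A`, and the truth
value of `X* ∈ A` is `j`. -/
abbrev Channel (d M : ℕ) : Type :=
  History d M → Fin M → Set (Loc d) → Bool → Bool → ℝ

/-- Every `f h m A j` is a probability mass function on `{0, 1}`. -/
def IsChannel {d M : ℕ} (f : Channel d M) : Prop :=
  ∀ h m A j, (∀ y, 0 ≤ f h m A j y) ∧ ∑ y, f h m A j y = 1

/-- The response probabilities depend neither on the history nor on the region that is asked. -/
def IsMemoryless {d M : ℕ} (f : Channel d M) : Prop :=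
  ∀ h h' m A A', f h m A = f h' m A'

/-- A probability density on `ℝ^d` whose differential entropy is finite. -/
structure IsDensity {d : ℕ} (p : Loc d → ℝ) : Prop where
  measurable : Measurable p
  nonneg : ∀ x, 0 ≤ p x
  integrable : Integrable p
  integral_eq_one : ∫ x, p x = 1
  integrable_entropy : Integrable fun x => p x * Real.log (p x)

/-- Differential entropy of a density. -/
def diffEntropy {d : ℕ} (p : Loc d → ℝ) : ℝ := -∫ x, p x * Real.log (p x)

/-- Shannon entropy of a probability mass function on a finite set. -/
def shannonEntropy {α : Type*} [Fintype α] (q : α → ℝ) : ℝ := -∑ y, q y * Real.log (q y)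

/-- The cell `⋂ₘ (A⁽ᵐ⁾)^{iₘ}` of the dyadic partition, with `A¹ = A` and `A⁰ = Aᶜ`. -/
def cell {d M : ℕ} (A : Queries d M) (i : Fin M → Bool) : Set (Loc d) :=
  ⋂ m, if i m = true then A m else (A m)ᶜ

/-- `g_{i₁:i_M}(y) = ∏ₘ f⁽ᵐ⁾_{iₘ}(y⁽ᵐ⁾)`. -/
def jointPMF {d M : ℕ} (f : Channel d M) (h : History d M) (A : Queries d M)
    (i : Fin M → Bool) (y : Responses M) : ℝ :=
  ∏ m, f h m (A m) (i m) (y m)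

/-- The quantity maximized by the optimal queries:
`H(∑ᵢ gᵢ P(cellᵢ)) - ∑ᵢ H(gᵢ) P(cellᵢ)`, where `P` has density `p`. -/
def gain {d M : ℕ} (f : Channel d M) (h : History d M) (p : Loc d → ℝ) (A : Queries d M) : ℝ :=
  shannonEntropy (fun y => ∑ i, jointPMF f h A i y * ∫ x in cell A i, p x)
    - ∑ i, shannonEntropy (jointPMF f h A i) * ∫ x in cell A i, p x

open Classical in
/-- `ℙ(Y_{n+1} = y | A_n = A, X* = x, F_n = h)` under conditional independence of the players. -/
def likelihood {d M : ℕ} (f : Channel d M) (h : History d M) (A : Queries d M)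
    (y : Responses M) (x : Loc d) : ℝ :=
  ∏ m, if x ∈ A m then f h m (A m) true (y m) else f h m (A m) false (y m)

/-- For a target of density `p`, the probability of an observation whose conditional
probability given `X* = x` is `L x`. -/
def evidence {d : ℕ} (p L : Loc d → ℝ) : ℝ := ∫ x, p x * L x

/-- Bayes' rule: the density of the target given an observation whose conditional
probability given `X* = x` is `L x`. -/
def bayes {d : ℕ} (p L : Loc d → ℝ) : Loc d → ℝ := fun x => p x * L x / evidence p L

/-- `𝔼[H(p_{n+1}) | A_n = A, F_n = h]`, when `p_n = p`. -/
def expectedNextEntropy {d M : ℕ} (f : Channel d M) (h : History d M) (p : Loc d → ℝ)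
    (A : Queries d M) : ℝ :=
  ∑ y, evidence p (likelihood f h A y) * diffEntropy (bayes p (likelihood f h A y))

/-- Batches of queries in which player `m` is asked a region of the class `Q n m`; `Q n m` is the
class of regions about which player `m` may be asked at time `n`. -/
abbrev Admissible {d M : ℕ} (Q : ℕ → Fin M → Set (Set (Loc d))) (n : ℕ) : Type :=
  {A : Queries d M // ∀ m, A m ∈ Q n m}

/-- The maximal one-step entropy loss `G*` at history `h` and posterior `p`. -/
def maxGain {d M : ℕ} (Q : ℕ → Fin M → Set (Set (Loc d))) (f : Channel d M) (h : History d M)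
    (p : Loc d → ℝ) : ℝ :=
  ⨆ A : Admissible Q h.length, gain f h p A.1

/-- A joint query policy chooses the next batch of admissible queries from the history. -/
abbrev Policy {d M : ℕ} (Q : ℕ → Fin M → Set (Set (Loc d))) : Type :=
  (h : History d M) → Admissible Q h.length

/-- The history that results if, starting from the history `h`, the queries are chosen by the
policy `ζ` and the successive responses are `ys`. -/
def run {d M : ℕ} {Q : ℕ → Fin M → Set (Set (Loc d))} (ζ : Policy Q) :
    History d M → List (Responses M) → History d M
  | h, [] => h
  | h, y :: ys => run ζ (h ++ [((ζ h).1, y)]) ys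

/-- The conditional probability, given `X* = x` and the history `h`, that the next responses under
the policy `ζ` are `ys`. -/
def pathLikelihood {d M : ℕ} {Q : ℕ → Fin M → Set (Set (Loc d))} (f : Channel d M)
    (ζ : Policy Q) : History d M → List (Responses M) → Loc d → ℝ
  | _, [], _ => 1
  | h, y :: ys, x =>
      likelihood f h (ζ h).1 y x * pathLikelihood f ζ (h ++ [((ζ h).1, y)]) ys x

/-- The probability of the responses `ys` under the policy `ζ`, starting from the history `h` and
the posterior `p`. -/
def pathProb {d M : ℕ} {Q : ℕ → Fin M → Set (Set (Loc d))} (f : Channel d M) (ζ : Policy Q)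
    (h : History d M) (p : Loc d → ℝ) (ys : List (Responses M)) : ℝ :=
  evidence p (pathLikelihood f ζ h ys)

/-- The posterior density after the responses `ys` under the policy `ζ`, starting from the history
`h` and the posterior `p`. -/
def posterior {d M : ℕ} {Q : ℕ → Fin M → Set (Set (Loc d))} (f : Channel d M) (ζ : Policy Q)
    (h : History d M) (p : Loc d → ℝ) (ys : List (Responses M)) : Loc d → ℝ :=
  bayes p (pathLikelihood f ζ h ys)

/-- `𝔼^ζ[H(p_N) | F_n = h, p_n = p]`, where `n` is the length of `h`. -/
def expectedFinalEntropy {d M : ℕ} {Q : ℕ → Fin M → Set (Set (Loc d))} (f : Channel d M) (N : ℕ)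
    (h : History d M) (p : Loc d → ℝ) (ζ : Policy Q) : ℝ :=
  ∑ ys : Fin (N - h.length) → Responses M,
    pathProb f ζ h p (List.ofFn ys) * diffEntropy (posterior f ζ h p (List.ofFn ys))

/-- The value function `V_n = inf_ζ 𝔼^ζ[H(p_N) | F_n = h, p_n = p]`, where `n` is the length
of `h`. -/
def value {d M : ℕ} (Q : ℕ → Fin M → Set (Set (Loc d))) (f : Channel d M) (N : ℕ)
    (h : History d M) (p : Loc d → ℝ) : ℝ :=
  ⨅ ζ : Policy Q, expectedFinalEntropy f N h p ζ

/-- The policy `ζ` minimizes the expected entropy after round `N`, starting from `h` and `p`. -/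
def IsOptimal {d M : ℕ} {Q : ℕ → Fin M → Set (Set (Loc d))} (f : Channel d M) (N : ℕ)
    (h : History d M) (p : Loc d → ℝ) (ζ : Policy Q) : Prop :=
  ∀ ζ' : Policy Q, expectedFinalEntropy f N h p ζ ≤ expectedFinalEntropy f N h p ζ'

/-- At each remaining step and in each situation that arises with positive probability, the queries
chosen by `ζ` attain the supremum that defines the maximal one-step entropy loss. -/
def IsGreedy {d M : ℕ} {Q : ℕ → Fin M → Set (Set (Loc d))} (f : Channel d M) (N : ℕ)
    (h : History d M) (p : Loc d → ℝ) (ζ : Policy Q) : Prop :=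
  ∀ ys : List (Responses M), h.length + ys.length < N → 0 < pathProb f ζ h p ys →
    gain f (run ζ h ys) (posterior f ζ h p ys) (ζ (run ζ h ys)).1
      = maxGain Q f (run ζ h ys) (posterior f ζ h p ys)

end TwentyQuestions

end

open TwentyQuestions

/-! Given the queries, the responses depend on `X*` only through the index of the cell containing
it. The expected entropy loss of a round is the mutual information between `X*` and the responses,
and reading it from the response side gives `H(Y) - H(Y | X*)`, which is `gain`. This follows by
splitting the logarithm in Bayes' rule and summing over the responses
(`diffEntropy_sub_expectedNextEntropy`).

Over several rounds the losses telescope. For any real `G`, the expected final entropy is `H(p) - (N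
- n) G` plus the expected shortfalls of the one-step gains below `G` (`expectedFinalEntropy_eq`). If
`G` is the maximal gain in every reachable situation, each shortfall is nonnegative, and all vanish
exactly for greedy policies. Nearly maximal queries make their sum arbitrarily small, so the infimum
is identified even when no greedy policy exists.

For memoryless channels the gain is a function of the cell probabilities alone, continuous on a
compact simplex, hence with a maximum (`exists_isMaxOn_mutualInfo`). A measure with a density on
`ℝ^d`, `d ≥ 1`, can be cut into pieces of any prescribed masses, so every point of the simplex is
realized by some queries (`exists_queries_integral_cell_eq`). The maximum is therefore the same for
all posteriors: it is the capacity of the joint channel. -/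

noncomputable section

namespace TwentyQuestions

variable {d M : ℕ}

/-! ### The cell that contains a point -/

open Classical in
/-- The truth values of `x ∈ A⁽ᵐ⁾`: the index of the cell that contains `x`. -/
def pattern (A : Queries d M) (x : Loc d) : Fin M → Bool := fun m => decide (x ∈ A m)

lemma mem_cell_iff (A : Queries d M) (i : Fin M → Bool) (x : Loc d) :
    x ∈ cell A i ↔ pattern A x = i := by
  simp only [cell, Set.mem_iInter, funext_iff, pattern]
  refine forall_congr' fun m => ?_
  cases i m <;> simp

lemma likelihood_eq (f : Channel d M) (h : History d M) (A : Queries d M) (y : Responses M)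
    (x : Loc d) : likelihood f h A y x = jointPMF f h A (pattern A x) y := by
  refine Finset.prod_congr rfl fun m _ => ?_
  by_cases hx : x ∈ A m <;> simp [pattern, hx]

lemma measurableSet_cell {A : Queries d M} (hA : ∀ m, MeasurableSet (A m)) (i : Fin M → Bool) :
    MeasurableSet (cell A i) := by
  refine MeasurableSet.iInter fun m => ?_
  split_ifs
  exacts [hA m, (hA m).compl]

lemma measurable_pattern {A : Queries d M} (hA : ∀ m, MeasurableSet (A m)) :
    Measurable (pattern A) := by
  refine measurable_to_countable' fun i => ?_
  convert measurableSet_cell hA i using 1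
  ext x
  simp [mem_cell_iff]

lemma measurable_comp_pattern {A : Queries d M} (hA : ∀ m, MeasurableSet (A m))
    (F : (Fin M → Bool) → ℝ) : Measurable fun x => F (pattern A x) :=
  (measurable_of_countable F).comp (measurable_pattern hA)

lemma integral_mul_comp_pattern {A : Queries d M} (hA : ∀ m, MeasurableSet (A m))
    {p : Loc d → ℝ} (hp : Integrable p) (F : (Fin M → Bool) → ℝ) :
    ∫ x, p x * F (pattern A x) = ∑ i, F i * ∫ x in cell A i, p x := by
  have h1 : (fun x => p x * F (pattern A x))
      = fun x => ∑ i, F i * (cell A i).indicator p x := by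
    funext x
    rw [Finset.sum_eq_single (pattern A x)]
    · rw [Set.indicator_of_mem ((mem_cell_iff _ _ _).2 rfl), mul_comm]
    · intro i _ hi
      rw [Set.indicator_of_notMem (fun hx => hi ((mem_cell_iff _ _ _).1 hx).symm), mul_zero]
    · simp
  rw [h1, integral_finsetSum _ fun i _ =>
    (hp.indicator (measurableSet_cell hA i)).const_mul (F i)]
  simp_rw [integral_const_mul, integral_indicator (measurableSet_cell hA _)]

lemma sum_integral_cell {A : Queries d M} (hA : ∀ m, MeasurableSet (A m))
    {p : Loc d → ℝ} (hp : Integrable p) : ∑ i, ∫ x in cell A i, p x = ∫ x, p x := by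
  simpa using (integral_mul_comp_pattern hA hp fun _ => 1).symm

/-! ### Joint response probabilities -/

lemma jointPMF_nonneg {f : Channel d M} (hf : IsChannel f) (h : History d M) (A : Queries d M)
    (i : Fin M → Bool) (y : Responses M) : 0 ≤ jointPMF f h A i y :=
  Finset.prod_nonneg fun m _ => (hf h m (A m) (i m)).1 (y m)

lemma sum_jointPMF {f : Channel d M} (hf : IsChannel f) (h : History d M) (A : Queries d M)
    (i : Fin M → Bool) : ∑ y, jointPMF f h A i y = 1 := by
  simp only [jointPMF]
  rw [← Fintype.prod_sum fun m y => f h m (A m) (i m) y]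
  exact Finset.prod_eq_one fun m _ => (hf h m (A m) (i m)).2

lemma jointPMF_le_one {f : Channel d M} (hf : IsChannel f) (h : History d M) (A : Queries d M)
    (i : Fin M → Bool) (y : Responses M) : jointPMF f h A i y ≤ 1 := by
  rw [← sum_jointPMF hf h A i]
  exact Finset.single_le_sum (f := jointPMF f h A i) (fun y _ => jointPMF_nonneg hf h A i y)
    (Finset.mem_univ y)

lemma likelihood_nonneg {f : Channel d M} (hf : IsChannel f) (h : History d M) (A : Queries d M)
    (y : Responses M) (x : Loc d) : 0 ≤ likelihood f h A y x := by
  rw [likelihood_eq]; exact jointPMF_nonneg hf h A _ y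

lemma likelihood_le_one {f : Channel d M} (hf : IsChannel f) (h : History d M) (A : Queries d M)
    (y : Responses M) (x : Loc d) : likelihood f h A y x ≤ 1 := by
  rw [likelihood_eq]; exact jointPMF_le_one hf h A _ y

lemma sum_likelihood {f : Channel d M} (hf : IsChannel f) (h : History d M) (A : Queries d M)
    (x : Loc d) : ∑ y, likelihood f h A y x = 1 := by
  simp_rw [likelihood_eq]; exact sum_jointPMF hf h A _

lemma measurable_likelihood (f : Channel d M) (h : History d M) {A : Queries d M}
    (hA : ∀ m, MeasurableSet (A m)) (y : Responses M) : Measurable (likelihood f h A y) := by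
  simp_rw [funext fun x => likelihood_eq f h A y x]
  exact measurable_comp_pattern hA fun i => jointPMF f h A i y

/-! ### Bayes' rule -/

lemma IsDensity.integrable_mul {p L : Loc d → ℝ} (hp : IsDensity p) (hL : Measurable L)
    (hL0 : ∀ x, 0 ≤ L x) (hL1 : ∀ x, L x ≤ 1) : Integrable fun x => p x * L x :=
  hp.integrable.mul_bdd (c := 1) hL.aestronglyMeasurable
    (Filter.Eventually.of_forall fun x => by
      rw [Real.norm_of_nonneg (hL0 x)]; exact hL1 x)

lemma IsDensity.evidence_nonneg {p L : Loc d → ℝ} (hp : IsDensity p) (hL0 : ∀ x, 0 ≤ L x) :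
    0 ≤ evidence p L :=
  integral_nonneg fun x => mul_nonneg (hp.nonneg x) (hL0 x)

lemma IsDensity.ae_eq_zero {p L : Loc d → ℝ} (hp : IsDensity p) (hL : Measurable L)
    (hL0 : ∀ x, 0 ≤ L x) (hL1 : ∀ x, L x ≤ 1) (he : evidence p L = 0) :
    (fun x => p x * L x) =ᵐ[volume] 0 :=
  (integral_eq_zero_iff_of_nonneg (fun x => mul_nonneg (hp.nonneg x) (hL0 x))
    (hp.integrable_mul hL hL0 hL1)).1 he

lemma IsDensity.integrable_mul_mul_log_self {p L : Loc d → ℝ} (hp : IsDensity p)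
    (hL : Measurable L) (hL0 : ∀ x, 0 ≤ L x) (hL1 : ∀ x, L x ≤ 1) :
    Integrable fun x => p x * (L x * Real.log (L x)) := by
  refine hp.integrable.mul_bdd (c := 1)
    (hL.mul (Real.measurable_log.comp hL)).aestronglyMeasurable ?_
  refine Filter.Eventually.of_forall fun x => ?_
  -- Since `-t log t ≤ 1 - t`, the factor `t log t` lies in `[-1, 0]` for `t` in `[0, 1]`.
  have h1 := Real.negMulLog_le_one_sub_self (hL0 x)
  have h2 := Real.mul_log_nonpos (hL0 x) (hL1 x)
  rw [Real.negMulLog] at h1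
  rw [Real.norm_of_nonpos h2]
  linarith [hL0 x]

lemma IsDensity.integrable_mul_log_mul {p L : Loc d → ℝ} (hp : IsDensity p) (hL : Measurable L)
    (hL0 : ∀ x, 0 ≤ L x) (hL1 : ∀ x, L x ≤ 1) :
    Integrable fun x => (p x * Real.log (p x)) * L x :=
  hp.integrable_entropy.mul_bdd (c := 1) hL.aestronglyMeasurable
    (Filter.Eventually.of_forall fun x => by
      rw [Real.norm_of_nonneg (hL0 x)]; exact hL1 x)

/-- The logarithm splits only where `p x` and `L x` are nonzero; elsewhere both sides vanish because
`0 * log 0 = 0`. -/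
lemma bayes_mul_log_bayes {p L : Loc d → ℝ} (he : evidence p L ≠ 0) (x : Loc d) :
    bayes p L x * Real.log (bayes p L x)
      = (evidence p L)⁻¹ * ((p x * Real.log (p x)) * L x + p x * (L x * Real.log (L x))
          - Real.log (evidence p L) * (p x * L x)) := by
  rw [bayes]
  by_cases hpx : p x = 0
  · simp [hpx]
  by_cases hLx : L x = 0
  · simp [hLx]
  rw [Real.log_div (mul_ne_zero hpx hLx) he, Real.log_mul hpx hLx]
  field_simp

lemma IsDensity.bayes {p L : Loc d → ℝ} (hp : IsDensity p) (hL : Measurable L)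
    (hL0 : ∀ x, 0 ≤ L x) (hL1 : ∀ x, L x ≤ 1) (he : 0 < evidence p L) :
    IsDensity (bayes p L) where
  measurable := (hp.measurable.mul hL).div_const _
  nonneg x := div_nonneg (mul_nonneg (hp.nonneg x) (hL0 x)) he.le
  integrable := (hp.integrable_mul hL hL0 hL1).div_const _
  integral_eq_one := by
    simp only [TwentyQuestions.bayes]
    rw [integral_div]
    exact div_self he.ne'
  integrable_entropy := by
    simp_rw [bayes_mul_log_bayes he.ne']
    exact (((hp.integrable_mul_log_mul hL hL0 hL1).add
      (hp.integrable_mul_mul_log_self hL hL0 hL1)).sub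
      ((hp.integrable_mul hL hL0 hL1).const_mul _)).const_mul _

/-- Weighting by the evidence removes the need for it to be positive: if it is zero, then `p * L`
vanishes almost everywhere and so does every term. Null responses thus need no separate treatment
when summing over `y`. -/
lemma IsDensity.evidence_mul_diffEntropy_bayes {p L : Loc d → ℝ} (hp : IsDensity p)
    (hL : Measurable L) (hL0 : ∀ x, 0 ≤ L x) (hL1 : ∀ x, L x ≤ 1) :
    evidence p L * diffEntropy (TwentyQuestions.bayes p L)
      = -(∫ x, (p x * Real.log (p x)) * L x) - (∫ x, p x * (L x * Real.log (L x)))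
        + evidence p L * Real.log (evidence p L) := by
  by_cases he : evidence p L = 0
  · have h0 := hp.ae_eq_zero hL hL0 hL1 he
    have h1 : ∫ x, (p x * Real.log (p x)) * L x = 0 := by
      refine integral_eq_zero_of_ae ?_
      filter_upwards [h0] with x hx
      simp only [Pi.zero_apply] at hx ⊢
      rw [mul_right_comm, hx, zero_mul]
    have h2 : ∫ x, p x * (L x * Real.log (L x)) = 0 := by
      refine integral_eq_zero_of_ae ?_
      filter_upwards [h0] with x hx
      simp only [Pi.zero_apply] at hx ⊢
      rw [← mul_assoc, hx, zero_mul]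
    rw [h1, h2, he]; simp
  · have hev : ∫ x, p x * L x = evidence p L := rfl
    rw [diffEntropy]
    simp_rw [bayes_mul_log_bayes he]
    have hadd : Integrable fun x => (p x * Real.log (p x)) * L x + p x * (L x * Real.log (L x)) :=
      (hp.integrable_mul_log_mul hL hL0 hL1).add (hp.integrable_mul_mul_log_self hL hL0 hL1)
    rw [integral_const_mul, integral_sub hadd ((hp.integrable_mul hL hL0 hL1).const_mul _),
      integral_add (hp.integrable_mul_log_mul hL hL0 hL1)
      (hp.integrable_mul_mul_log_self hL hL0 hL1), integral_const_mul, hev]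
    field_simp
    ring

lemma evidence_bayes (p L L' : Loc d → ℝ) :
    evidence (bayes p L) L' = evidence p (fun x => L x * L' x) / evidence p L := by
  simp only [evidence, bayes]
  rw [← integral_div]
  congr 1; funext x; ring

lemma bayes_bayes {p L : Loc d → ℝ} (L' : Loc d → ℝ) (he : evidence p L ≠ 0) :
    bayes (bayes p L) L' = bayes p fun x => L x * L' x := by
  funext x
  rw [bayes, evidence_bayes, bayes, bayes]
  -- If the combined observation has zero evidence, both sides divide by zero and are zero.
  by_cases h0 : evidence p (fun x => L x * L' x) = 0
  · simp [h0]
  field_simp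

/-! ### The expected entropy loss in one round -/

lemma evidence_likelihood (f : Channel d M) (h : History d M) {p : Loc d → ℝ}
    (hp : Integrable p) {A : Queries d M} (hA : ∀ m, MeasurableSet (A m)) (y : Responses M) :
    evidence p (likelihood f h A y) = ∑ i, jointPMF f h A i y * ∫ x in cell A i, p x := by
  simp only [evidence, likelihood_eq]
  exact integral_mul_comp_pattern hA hp fun i => jointPMF f h A i y

theorem diffEntropy_sub_expectedNextEntropy {f : Channel d M} (hf : IsChannel f)
    (h : History d M) {p : Loc d → ℝ} (hp : IsDensity p) {A : Queries d M}
    (hA : ∀ m, MeasurableSet (A m)) :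
    diffEntropy p - expectedNextEntropy f h p A = gain f h p A := by
  have hL := fun y => measurable_likelihood f h hA y
  have hL0 := fun y x => likelihood_nonneg hf h A y x
  have hL1 := fun y x => likelihood_le_one hf h A y x
  -- The three sums over `y` are, up to sign, the prior entropy, the conditional entropy of the
  -- responses given the target, and the entropy of the responses.
  have e1 : ∑ y, ∫ x, (p x * Real.log (p x)) * likelihood f h A y x
      = ∫ x, p x * Real.log (p x) := by
    rw [← integral_finsetSum _ fun y _ => hp.integrable_mul_log_mul (hL y) (hL0 y) (hL1 y)]
    simp_rw [← Finset.mul_sum, sum_likelihood hf, mul_one]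
  have e2 : ∑ y, ∫ x, p x * (likelihood f h A y x * Real.log (likelihood f h A y x))
      = -∑ i, shannonEntropy (jointPMF f h A i) * ∫ x in cell A i, p x := by
    simp_rw [likelihood_eq]
    have (y : Responses M) := integral_mul_comp_pattern hA hp.integrable
      fun i => jointPMF f h A i y * Real.log (jointPMF f h A i y)
    simp_rw [this]
    rw [Finset.sum_comm, ← Finset.sum_neg_distrib]
    refine Finset.sum_congr rfl fun i _ => ?_
    rw [shannonEntropy, ← Finset.sum_mul]; ring
  have e3 : ∑ y, evidence p (likelihood f h A y) * Real.log (evidence p (likelihood f h A y))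
      = -shannonEntropy (fun y => ∑ i, jointPMF f h A i y * ∫ x in cell A i, p x) := by
    simp_rw [evidence_likelihood f h hp.integrable hA]
    rw [shannonEntropy, neg_neg]
  rw [expectedNextEntropy, gain, Finset.sum_congr rfl fun y _ =>
    hp.evidence_mul_diffEntropy_bayes (hL y) (hL0 y) (hL1 y), Finset.sum_add_distrib,
    Finset.sum_sub_distrib, Finset.sum_neg_distrib, e1, e2, e3, diffEntropy]
  ring

lemma shannonEntropy_nonneg {α : Type*} [Fintype α] {q : α → ℝ} (h0 : ∀ y, 0 ≤ q y)
    (h1 : ∀ y, q y ≤ 1) : 0 ≤ shannonEntropy q :=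
  neg_nonneg.2 (Finset.sum_nonpos fun y _ => Real.mul_log_nonpos (h0 y) (h1 y))

lemma shannonEntropy_le_card {α : Type*} [Fintype α] {q : α → ℝ} (h0 : ∀ y, 0 ≤ q y) :
    shannonEntropy q ≤ Fintype.card α := by
  rw [shannonEntropy, ← Finset.sum_neg_distrib, ← Finset.card_univ, ← nsmul_one]
  refine Finset.sum_le_card_nsmul _ _ _ fun y _ => ?_
  have := Real.negMulLog_le_one_sub_self (h0 y)
  rw [Real.negMulLog] at this
  linarith [h0 y]

lemma IsDensity.integral_cell_nonneg {p : Loc d → ℝ} (hp : IsDensity p) (A : Queries d M)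
    (i : Fin M → Bool) : 0 ≤ ∫ x in cell A i, p x :=
  integral_nonneg fun x => hp.nonneg x

lemma gain_le_card {f : Channel d M} (hf : IsChannel f) (h : History d M) {p : Loc d → ℝ}
    (hp : IsDensity p) (A : Queries d M) : gain f h p A ≤ Fintype.card (Responses M) := by
  have h1 := shannonEntropy_le_card
    (q := fun y => ∑ i, jointPMF f h A i y * ∫ x in cell A i, p x) fun y =>
      Finset.sum_nonneg fun i _ =>
        mul_nonneg (jointPMF_nonneg hf h A i y) (hp.integral_cell_nonneg A i)
  have h2 : 0 ≤ ∑ i, shannonEntropy (jointPMF f h A i) * ∫ x in cell A i, p x :=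
    Finset.sum_nonneg fun i _ => mul_nonneg (shannonEntropy_nonneg (jointPMF_nonneg hf h A i)
      (jointPMF_le_one hf h A i)) (hp.integral_cell_nonneg A i)
  rw [gain]; linarith

lemma nonempty_admissible {Q : ℕ → Fin M → Set (Set (Loc d))} (hQ : ∀ n m, (Q n m).Nonempty)
    (n : ℕ) : Nonempty (Admissible Q n) :=
  ⟨⟨fun m => (hQ n m).some, fun m => (hQ n m).some_mem⟩⟩

/-- A real `⨆` is a true supremum only over a nonempty bounded family; the crude bound
`gain_le_card` suffices for this. -/
lemma isLUB_maxGain {Q : ℕ → Fin M → Set (Set (Loc d))} (hQ : ∀ n m, (Q n m).Nonempty)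
    {f : Channel d M} (hf : IsChannel f) (h : History d M) {p : Loc d → ℝ} (hp : IsDensity p) :
    IsLUB (Set.range fun A : Admissible Q h.length => gain f h p A.1) (maxGain Q f h p) := by
  have := nonempty_admissible hQ h.length
  exact isLUB_ciSup ⟨_, Set.forall_mem_range.2 fun A => gain_le_card hf h hp A.1⟩

/-! ### Several rounds -/

section Paths

variable {Q : ℕ → Fin M → Set (Set (Loc d))} {f : Channel d M}

lemma pathLikelihood_nonneg (hf : IsChannel f) (ζ : Policy Q) (h : History d M)
    (ys : List (Responses M)) (x : Loc d) : 0 ≤ pathLikelihood f ζ h ys x := by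
  induction ys generalizing h with
  | nil => exact zero_le_one
  | cons y ys ih => exact mul_nonneg (likelihood_nonneg hf _ _ _ _) (ih _)

lemma pathLikelihood_le_one (hf : IsChannel f) (ζ : Policy Q) (h : History d M)
    (ys : List (Responses M)) (x : Loc d) : pathLikelihood f ζ h ys x ≤ 1 := by
  induction ys generalizing h with
  | nil => exact le_rfl
  | cons y ys ih =>
    exact mul_le_one₀ (likelihood_le_one hf _ _ _ _) (pathLikelihood_nonneg hf _ _ _ _) (ih _)

lemma measurable_pathLikelihood (hQ : ∀ n m, ∀ A ∈ Q n m, MeasurableSet A) (f : Channel d M)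
    (ζ : Policy Q) (h : History d M) (ys : List (Responses M)) :
    Measurable (pathLikelihood f ζ h ys) := by
  induction ys generalizing h with
  | nil => exact measurable_const
  | cons y ys ih =>
    exact (measurable_likelihood f h (fun m => hQ _ m _ ((ζ h).2 m)) y).mul (ih _)

/-- Paths are defined by recursion on the first response, whereas telescoping requires peeling off
the last one. -/
lemma pathLikelihood_append_singleton (f : Channel d M) (ζ : Policy Q) (h : History d M)
    (ys : List (Responses M)) (y : Responses M) :
    pathLikelihood f ζ h (ys ++ [y]) = fun x => pathLikelihood f ζ h ys x *
      likelihood f (run ζ h ys) (ζ (run ζ h ys)).1 y x := by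
  funext x
  induction ys generalizing h with
  | nil => simp [pathLikelihood, run]
  | cons z ys ih => simp only [List.cons_append, pathLikelihood, run, ih, mul_assoc]

lemma pathProb_nonneg (hf : IsChannel f) (ζ : Policy Q) (h : History d M) {p : Loc d → ℝ}
    (hp : IsDensity p) (ys : List (Responses M)) : 0 ≤ pathProb f ζ h p ys :=
  hp.evidence_nonneg (pathLikelihood_nonneg hf ζ h ys)

lemma isDensity_posterior (hf : IsChannel f) (hQ : ∀ n m, ∀ A ∈ Q n m, MeasurableSet A)
    (ζ : Policy Q) (h : History d M) {p : Loc d → ℝ} (hp : IsDensity p)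
    {ys : List (Responses M)} (hys : 0 < pathProb f ζ h p ys) :
    IsDensity (posterior f ζ h p ys) :=
  hp.bayes (measurable_pathLikelihood hQ f ζ h ys) (pathLikelihood_nonneg hf ζ h ys)
    (pathLikelihood_le_one hf ζ h ys) hys

lemma sum_pathProb_append_singleton (hf : IsChannel f)
    (hQ : ∀ n m, ∀ A ∈ Q n m, MeasurableSet A) (ζ : Policy Q) (h : History d M)
    {p : Loc d → ℝ} (hp : IsDensity p) (ys : List (Responses M)) :
    ∑ y, pathProb f ζ h p (ys ++ [y]) = pathProb f ζ h p ys := by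
  simp only [pathProb, evidence]
  rw [← integral_finsetSum _ fun y _ => hp.integrable_mul
    (measurable_pathLikelihood hQ f ζ h _) (pathLikelihood_nonneg hf ζ h _)
    (pathLikelihood_le_one hf ζ h _)]
  simp_rw [pathLikelihood_append_singleton, ← Finset.mul_sum, sum_likelihood hf, mul_one]

/-- The decrease of the expected entropy in the round that follows the responses `ys`. -/
lemma sum_pathProb_mul_diffEntropy_append_singleton (hf : IsChannel f)
    (hQ : ∀ n m, ∀ A ∈ Q n m, MeasurableSet A) (ζ : Policy Q) (h : History d M)
    {p : Loc d → ℝ} (hp : IsDensity p) (ys : List (Responses M)) :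
    ∑ y, pathProb f ζ h p (ys ++ [y]) * diffEntropy (posterior f ζ h p (ys ++ [y]))
      = pathProb f ζ h p ys * (diffEntropy (posterior f ζ h p ys)
        - gain f (run ζ h ys) (posterior f ζ h p ys) (ζ (run ζ h ys)).1) := by
  -- On a null path the posterior is meaningless, but all one-step extensions are null too, so both
  -- sides are zero.
  rcases (pathProb_nonneg hf ζ h hp ys).eq_or_lt with h0 | hpos
  · have hsum := sum_pathProb_append_singleton hf hQ ζ h hp ys
    rw [← h0, Finset.sum_eq_zero_iff_of_nonneg fun y _ => pathProb_nonneg hf ζ h hp _] at hsum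
    rw [← h0, zero_mul]
    exact Finset.sum_eq_zero fun y hy => by rw [hsum y hy, zero_mul]
  · have hne : evidence p (pathLikelihood f ζ h ys) ≠ 0 := hpos.ne'
    rw [← diffEntropy_sub_expectedNextEntropy hf (run ζ h ys)
      (isDensity_posterior hf hQ ζ h hp hpos)
      (fun m => hQ _ m _ ((ζ (run ζ h ys)).2 m)), sub_sub_cancel, expectedNextEntropy,
      Finset.mul_sum]
    refine Finset.sum_congr rfl fun y _ => ?_
    simp only [posterior, pathProb]
    rw [bayes_bayes _ hne, evidence_bayes, pathLikelihood_append_singleton]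
    field_simp

lemma sum_ofFn_succ {α β : Type*} [Fintype α] [AddCommMonoid β] (k : ℕ) (F : List α → β) :
    ∑ ys : Fin (k + 1) → α, F (List.ofFn ys)
      = ∑ ys : Fin k → α, ∑ y, F (List.ofFn ys ++ [y]) := by
  rw [← (Fin.snocEquiv fun _ : Fin (k + 1) => α).sum_comp, Fintype.sum_prod_type_right]
  refine Finset.sum_congr rfl fun ys _ => Finset.sum_congr rfl fun y _ => ?_
  rw [List.ofFn_succ']
  simp [Fin.snocEquiv, List.concat_eq_append]

lemma pathProb_nil (ζ : Policy Q) (h : History d M) {p : Loc d → ℝ} (hp : IsDensity p) :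
    pathProb f ζ h p [] = 1 := by
  simp [pathProb, evidence, pathLikelihood, hp.integral_eq_one]

lemma posterior_nil (ζ : Policy Q) (h : History d M) {p : Loc d → ℝ} (hp : IsDensity p) :
    posterior f ζ h p [] = p := by
  funext x
  have := pathProb_nil (f := f) ζ h hp
  rw [pathProb] at this
  rw [posterior, bayes, this, pathLikelihood, mul_one, div_one]

lemma sum_pathProb (hf : IsChannel f) (hQ : ∀ n m, ∀ A ∈ Q n m, MeasurableSet A)
    (ζ : Policy Q) (h : History d M) {p : Loc d → ℝ} (hp : IsDensity p) (k : ℕ) :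
    ∑ ys : Fin k → Responses M, pathProb f ζ h p (List.ofFn ys) = 1 := by
  induction k with
  | zero => simp [pathProb_nil ζ h hp]
  | succ k ih =>
    rw [sum_ofFn_succ k (pathProb f ζ h p)]
    simp_rw [sum_pathProb_append_singleton hf hQ ζ h hp, ih]

/-- The expected amount by which `ζ` falls short of the loss `G` in the round that follows the
next `j` responses. -/
def shortfall (f : Channel d M) (ζ : Policy Q) (h : History d M) (p : Loc d → ℝ) (G : ℝ)
    (j : ℕ) : ℝ :=
  ∑ ys : Fin j → Responses M, pathProb f ζ h p (List.ofFn ys) *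
    (G - gain f (run ζ h (List.ofFn ys)) (posterior f ζ h p (List.ofFn ys))
      (ζ (run ζ h (List.ofFn ys))).1)

/-- The number `G` is arbitrary here: it is subtracted in each round and restored inside the
shortfall. -/
lemma expected_entropy_after (hf : IsChannel f) (hQ : ∀ n m, ∀ A ∈ Q n m, MeasurableSet A)
    (ζ : Policy Q) (h : History d M) {p : Loc d → ℝ} (hp : IsDensity p) (G : ℝ) (k : ℕ) :
    ∑ ys : Fin k → Responses M,
        pathProb f ζ h p (List.ofFn ys) * diffEntropy (posterior f ζ h p (List.ofFn ys))
      = diffEntropy p - k * G + ∑ j ∈ Finset.range k, shortfall f ζ h p G j := by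
  induction k with
  | zero => simp [pathProb_nil ζ h hp, posterior_nil ζ h hp]
  | succ k ih =>
    rw [sum_ofFn_succ k fun l => pathProb f ζ h p l * diffEntropy (posterior f ζ h p l),
      Finset.sum_range_succ, shortfall]
    have h1 := sum_pathProb hf hQ ζ h hp k
    simp_rw [sum_pathProb_mul_diffEntropy_append_singleton hf hQ ζ h hp, mul_sub]
    simp_rw [Finset.sum_sub_distrib, ← Finset.sum_mul, ih, h1]
    push_cast
    ring

lemma expectedFinalEntropy_eq (hf : IsChannel f) (hQ : ∀ n m, ∀ A ∈ Q n m, MeasurableSet A)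
    (ζ : Policy Q) {N : ℕ} {h : History d M} (hN : h.length ≤ N) {p : Loc d → ℝ}
    (hp : IsDensity p) (G : ℝ) :
    expectedFinalEntropy f N h p ζ = diffEntropy p - ((N : ℝ) - h.length) * G
      + ∑ j ∈ Finset.range (N - h.length), shortfall f ζ h p G j := by
  rw [expectedFinalEntropy, expected_entropy_after hf hQ ζ h hp G, Nat.cast_sub hN]

/-! ### Policies that depend on the posterior -/

/-- The conditional probability, given `X* = x` and the history `h`, of the responses recorded in
the continuation `s` of `h`, when the queries are those recorded in `s`. -/
def continuationLikelihood (f : Channel d M) : History d M → History d M → Loc d → ℝ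
  | _, [], _ => 1
  | h, q :: s, x => likelihood f h q.1 q.2 x * continuationLikelihood f (h ++ [q]) s x

lemma exists_run_eq_append (f : Channel d M) (ζ : Policy Q) (h : History d M)
    (ys : List (Responses M)) :
    ∃ s, run ζ h ys = h ++ s ∧ pathLikelihood f ζ h ys = continuationLikelihood f h s := by
  induction ys generalizing h with
  | nil => exact ⟨[], by simp [run], rfl⟩
  | cons y ys ih =>
    obtain ⟨s, hs, hL⟩ := ih (h ++ [((ζ h).1, y)])
    refine ⟨((ζ h).1, y) :: s, by simp [run, hs], ?_⟩
    funext x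
    simp [pathLikelihood, continuationLikelihood, hL]

/-- A policy sees only the history, but the history records queries and responses and so determines
the posterior: the likelihood can be recomputed without knowing the policy, which avoids a circular
definition. -/
lemma exists_policy_of_selector (f : Channel d M) (h : History d M) (p : Loc d → ℝ)
    (S : (h' : History d M) → (Loc d → ℝ) → Admissible Q h'.length) :
    ∃ ζ : Policy Q, ∀ ys, ζ (run ζ h ys) = S (run ζ h ys) (posterior f ζ h p ys) := by
  let ζ : Policy Q := fun h' => S h' (bayes p (continuationLikelihood f h (h'.drop h.length)))
  refine ⟨ζ, fun ys => ?_⟩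
  obtain ⟨s, hs, hL⟩ := exists_run_eq_append f ζ h ys
  have : bayes p (continuationLikelihood f h ((run ζ h ys).drop h.length))
      = posterior f ζ h p ys := by
    rw [posterior, hL, hs, List.drop_left]
  exact congrArg (S (run ζ h ys)) this

/-! ### The value function -/

section Value

variable {N : ℕ} {h : History d M} {p : Loc d → ℝ} {G : ℝ}

lemma pathProb_mul_nonneg_of_constant_maxGain (hf : IsChannel f)
    (hne : ∀ n m, (Q n m).Nonempty) (hQ : ∀ n m, ∀ A ∈ Q n m, MeasurableSet A)
    (hp : IsDensity p)
    (hG : ∀ (ζ : Policy Q) (ys : List (Responses M)), h.length + ys.length < N →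
      0 < pathProb f ζ h p ys → maxGain Q f (run ζ h ys) (posterior f ζ h p ys) = G)
    (ζ : Policy Q) {ys : List (Responses M)} (hys : h.length + ys.length < N) :
    0 ≤ pathProb f ζ h p ys *
      (G - gain f (run ζ h ys) (posterior f ζ h p ys) (ζ (run ζ h ys)).1) := by
  rcases (pathProb_nonneg hf ζ h hp ys).eq_or_lt with h0 | hpos
  · rw [← h0, zero_mul]
  · refine mul_nonneg hpos.le (sub_nonneg.2 ?_)
    rw [← hG ζ ys hys hpos]
    exact (isLUB_maxGain hne hf _ (isDensity_posterior hf hQ ζ h hp hpos)).1 ⟨_, rfl⟩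

lemma length_add_length_ofFn_lt {j : ℕ} (hj : j ∈ Finset.range (N - h.length))
    (ys : Fin j → Responses M) : h.length + (List.ofFn ys).length < N := by
  rw [Finset.mem_range] at hj
  rw [List.length_ofFn]
  omega

lemma sum_shortfall_nonneg (hf : IsChannel f)
    (hne : ∀ n m, (Q n m).Nonempty) (hQ : ∀ n m, ∀ A ∈ Q n m, MeasurableSet A)
    (hp : IsDensity p)
    (hG : ∀ (ζ : Policy Q) (ys : List (Responses M)), h.length + ys.length < N →
      0 < pathProb f ζ h p ys → maxGain Q f (run ζ h ys) (posterior f ζ h p ys) = G)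
    (ζ : Policy Q) : 0 ≤ ∑ j ∈ Finset.range (N - h.length), shortfall f ζ h p G j :=
  Finset.sum_nonneg fun _ hj => Finset.sum_nonneg fun ys _ =>
    pathProb_mul_nonneg_of_constant_maxGain hf hne hQ hp hG ζ (length_add_length_ofFn_lt hj ys)

/-- A finite sum of nonnegative terms vanishes only if every term does; null paths contribute
nothing and carry no greedy condition. -/
lemma isGreedy_iff_sum_shortfall_eq_zero (hf : IsChannel f)
    (hne : ∀ n m, (Q n m).Nonempty) (hQ : ∀ n m, ∀ A ∈ Q n m, MeasurableSet A)
    (hp : IsDensity p)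
    (hG : ∀ (ζ : Policy Q) (ys : List (Responses M)), h.length + ys.length < N →
      0 < pathProb f ζ h p ys → maxGain Q f (run ζ h ys) (posterior f ζ h p ys) = G)
    (ζ : Policy Q) :
    IsGreedy f N h p ζ ↔ ∑ j ∈ Finset.range (N - h.length), shortfall f ζ h p G j = 0 := by
  have hnn := fun {ys : List (Responses M)} (hys : h.length + ys.length < N) =>
    pathProb_mul_nonneg_of_constant_maxGain hf hne hQ hp hG ζ hys
  have hnn' : ∀ j ∈ Finset.range (N - h.length), 0 ≤ shortfall f ζ h p G j := fun j hj =>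
    Finset.sum_nonneg fun ys _ => hnn (length_add_length_ofFn_lt hj ys)
  rw [Finset.sum_eq_zero_iff_of_nonneg hnn']
  constructor
  · intro hgr j hj
    refine Finset.sum_eq_zero fun ys _ => ?_
    have hys := length_add_length_ofFn_lt hj ys
    rcases (pathProb_nonneg hf ζ h hp (List.ofFn ys)).eq_or_lt with h0 | hpos
    · rw [← h0, zero_mul]
    · rw [hgr _ hys hpos, hG ζ _ hys hpos, sub_self, mul_zero]
  · intro hz ys hys hpos
    have hj : ys.length ∈ Finset.range (N - h.length) := by rw [Finset.mem_range]; omega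
    have h1 := hz _ hj
    rw [shortfall, Finset.sum_eq_zero_iff_of_nonneg fun ys _ =>
      hnn (length_add_length_ofFn_lt hj ys)] at h1
    have h2 := h1 ys.get (Finset.mem_univ _)
    rw [List.ofFn_get] at h2
    rw [hG ζ ys hys hpos]
    linarith [(mul_eq_zero.1 h2).resolve_left hpos.ne']

lemma exists_admissible_gain_gt (hf : IsChannel f) (hne : ∀ n m, (Q n m).Nonempty)
    (h : History d M) (hp : IsDensity p) {ε : ℝ} (hε : 0 < ε) :
    ∃ A : Admissible Q h.length, maxGain Q f h p - ε < gain f h p A.1 := by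
  obtain ⟨_, ⟨A, rfl⟩, hA⟩ := (lt_isLUB_iff (isLUB_maxGain hne hf h hp)).1
    (sub_lt_self (maxGain Q f h p) hε)
  exact ⟨A, hA⟩

/-- The maximal gain need not be attained, so queries are chosen within `ε` of it in each round. -/
lemma exists_policy_sum_shortfall_le (hf : IsChannel f)
    (hne : ∀ n m, (Q n m).Nonempty) (hQ : ∀ n m, ∀ A ∈ Q n m, MeasurableSet A)
    (hp : IsDensity p)
    (hG : ∀ (ζ : Policy Q) (ys : List (Responses M)), h.length + ys.length < N →
      0 < pathProb f ζ h p ys → maxGain Q f (run ζ h ys) (posterior f ζ h p ys) = G)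
    {ε : ℝ} (hε : 0 < ε) :
    ∃ ζ : Policy Q, ∑ j ∈ Finset.range (N - h.length), shortfall f ζ h p G j
      ≤ (N - h.length : ℕ) * ε := by
  -- The selector must be total; its value at functions that are not densities is arbitrary.
  have hS : ∀ (h' : History d M) (p' : Loc d → ℝ), ∃ A : Admissible Q h'.length,
      IsDensity p' → maxGain Q f h' p' - ε < gain f h' p' A.1 := by
    intro h' p'
    by_cases hp' : IsDensity p'
    · obtain ⟨A, hA⟩ := exists_admissible_gain_gt hf hne h' hp' hε
      exact ⟨A, fun _ => hA⟩
    · exact ⟨(nonempty_admissible hne _).some, fun hc => absurd hc hp'⟩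
  choose S hS using hS
  obtain ⟨ζ, hζ⟩ := exists_policy_of_selector f h p S
  refine ⟨ζ, ?_⟩
  have hle : ∀ j ∈ Finset.range (N - h.length), shortfall f ζ h p G j ≤ ε := by
    intro j hj
    calc shortfall f ζ h p G j
        ≤ ∑ ys : Fin j → Responses M, pathProb f ζ h p (List.ofFn ys) * ε := by
          refine Finset.sum_le_sum fun ys _ => ?_
          rcases (pathProb_nonneg hf ζ h hp (List.ofFn ys)).eq_or_lt with h0 | hpos
          · rw [← h0, zero_mul, zero_mul]
          · refine mul_le_mul_of_nonneg_left ?_ hpos.le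
            have h1 := hS (run ζ h (List.ofFn ys)) _ (isDensity_posterior hf hQ ζ h hp hpos)
            rw [← hζ, hG ζ _ (length_add_length_ofFn_lt hj ys) hpos] at h1
            linarith
      _ = ε := by rw [← Finset.sum_mul, sum_pathProb hf hQ ζ h hp, one_mul]
  simpa using Finset.sum_le_card_nsmul _ _ _ hle

theorem value_of_constant_maxGain (hf : IsChannel f)
    (hne : ∀ n m, (Q n m).Nonempty) (hQ : ∀ n m, ∀ A ∈ Q n m, MeasurableSet A)
    (hp : IsDensity p) (hN : h.length ≤ N)
    (hG : ∀ (ζ : Policy Q) (ys : List (Responses M)), h.length + ys.length < N →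
      0 < pathProb f ζ h p ys → maxGain Q f (run ζ h ys) (posterior f ζ h p ys) = G) :
    IsGLB (Set.range fun ζ : Policy Q => expectedFinalEntropy f N h p ζ) (value Q f N h p) ∧
    value Q f N h p = diffEntropy p - ((N : ℝ) - h.length) * G ∧
    ∀ ζ : Policy Q, IsOptimal f N h p ζ ↔ IsGreedy f N h p ζ := by
  have hE := fun ζ : Policy Q => expectedFinalEntropy_eq hf hQ ζ hN hp G
  have hnn := sum_shortfall_nonneg hf hne hQ hp hG
  have hglb : IsGLB (Set.range fun ζ : Policy Q => expectedFinalEntropy f N h p ζ)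
      (diffEntropy p - ((N : ℝ) - h.length) * G) := by
    refine ⟨?_, fun b hb => ?_⟩
    · rintro _ ⟨ζ, rfl⟩
      simp only [hE]
      linarith [hnn ζ]
    · refine le_of_forall_pos_le_add fun δ hδ => ?_
      -- The added one keeps the denominator positive when no rounds remain.
      have hk : (0 : ℝ) < (N - h.length : ℕ) + 1 := by positivity
      obtain ⟨ζ, hζ⟩ := exists_policy_sum_shortfall_le hf hne hQ hp hG (div_pos hδ hk)
      have h1 : b ≤ expectedFinalEntropy f N h p ζ := hb ⟨ζ, rfl⟩
      have h2 : ((N - h.length : ℕ) : ℝ) * (δ / ((N - h.length : ℕ) + 1)) ≤ δ := by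
        rw [mul_div_assoc', div_le_iff₀ hk]
        nlinarith
      rw [hE] at h1
      linarith
  have : Nonempty (Policy Q) := ⟨fun h' => (nonempty_admissible hne _).some⟩
  have hval : value Q f N h p = diffEntropy p - ((N : ℝ) - h.length) * G := hglb.ciInf_eq
  refine ⟨hval ▸ hglb, hval, fun ζ => ?_⟩
  rw [isGreedy_iff_sum_shortfall_eq_zero hf hne hQ hp hG]
  constructor
  · intro hopt
    have h1 := hglb.2 (Set.forall_mem_range.2 hopt)
    rw [hE] at h1
    linarith [hnn ζ]
  · intro hz ζ'
    rw [hE, hE, hz]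
    linarith [hnn ζ']

lemma exists_isGreedy (hf : IsChannel f) (hne : ∀ n m, (Q n m).Nonempty)
    (hQ : ∀ n m, ∀ A ∈ Q n m, MeasurableSet A) (hp : IsDensity p)
    (hatt : ∀ (h' : History d M) (p' : Loc d → ℝ), IsDensity p' →
      ∃ A : Admissible Q h'.length, gain f h' p' A.1 = maxGain Q f h' p') :
    ∃ ζ : Policy Q, IsGreedy f N h p ζ := by
  have hS : ∀ (h' : History d M) (p' : Loc d → ℝ), ∃ A : Admissible Q h'.length,
      IsDensity p' → gain f h' p' A.1 = maxGain Q f h' p' := by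
    intro h' p'
    by_cases hp' : IsDensity p'
    · obtain ⟨A, hA⟩ := hatt h' p' hp'
      exact ⟨A, fun _ => hA⟩
    · exact ⟨(nonempty_admissible hne _).some, fun hc => absurd hc hp'⟩
  choose S hS using hS
  obtain ⟨ζ, hζ⟩ := exists_policy_of_selector f h p S
  refine ⟨ζ, fun ys _ hpos => ?_⟩
  rw [hζ]
  exact hS _ _ (isDensity_posterior hf hQ ζ h hp hpos)

end Value

end Paths

/-! ### Query regions with prescribed cell probabilities -/

/-- By dominated convergence with bound `‖p‖`: near `t₀`, membership of `x` in the ball changes only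
if `‖x‖ = t₀`, and spheres are null because `d > 0`. In dimension zero the sphere of radius zero
would carry mass. -/
lemma continuous_integral_inter_closedBall (hd : 0 < d) {p : Loc d → ℝ} (hp : Integrable p)
    {S : Set (Loc d)} (hS : MeasurableSet S) :
    Continuous fun t : ℝ => ∫ x in S ∩ Metric.closedBall 0 t, p x := by
  have hne : Nonempty (Fin d) := ⟨⟨0, hd⟩⟩
  have hmeas : ∀ t : ℝ, MeasurableSet (S ∩ Metric.closedBall (0 : Loc d) t) := fun t =>
    hS.inter Metric.isClosed_closedBall.measurableSet
  simp_rw [← integral_indicator (hmeas _)]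
  rw [continuous_iff_continuousAt]
  intro t₀
  refine continuousAt_of_dominated (bound := fun x => ‖p x‖)
    (Filter.Eventually.of_forall fun t => (hp.indicator (hmeas t)).aestronglyMeasurable)
    (Filter.Eventually.of_forall fun t => Filter.Eventually.of_forall fun x =>
      norm_indicator_le_norm_self _ _) hp.norm ?_
  have hsphere : ∀ᵐ x : Loc d, x ∉ Metric.sphere (0 : Loc d) t₀ :=
    measure_eq_zero_iff_ae_notMem.1 (Measure.addHaar_sphere volume 0 t₀)
  filter_upwards [hsphere] with x hx
  rw [mem_sphere_zero_iff_norm] at hx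
  have hev : ∀ᶠ t in nhds t₀, (‖x‖ ≤ t ↔ ‖x‖ ≤ t₀) := by
    rcases lt_or_gt_of_ne hx with hlt | hgt
    · filter_upwards [lt_mem_nhds hlt] with t ht
      exact iff_of_true ht.le hlt.le
    · filter_upwards [gt_mem_nhds hgt] with t ht
      exact iff_of_false (not_le.2 ht) (not_le.2 hgt)
  refine (continuousAt_const (y := (S ∩ Metric.closedBall 0 t₀).indicator p x)).congr ?_
  filter_upwards [hev] with t ht
  have hiff : x ∈ S ∩ Metric.closedBall 0 t ↔ x ∈ S ∩ Metric.closedBall 0 t₀ := by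
    rw [Set.mem_inter_iff, Set.mem_inter_iff, mem_closedBall_zero_iff, mem_closedBall_zero_iff, ht]
  by_cases hmem : x ∈ S ∩ Metric.closedBall 0 t₀
  · rw [Set.indicator_of_mem hmem, Set.indicator_of_mem (hiff.2 hmem)]
  · rw [Set.indicator_of_notMem hmem, Set.indicator_of_notMem (mt hiff.1 hmem)]

lemma exists_subset_integral_eq (hd : 0 < d) {p : Loc d → ℝ} (hp : Integrable p)
    {S : Set (Loc d)} (hS : MeasurableSet S) {c : ℝ} (hc0 : 0 ≤ c)
    (hc : c ≤ ∫ x in S, p x) : ∃ T ⊆ S, MeasurableSet T ∧ ∫ x in T, p x = c := by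
  -- The full mass is set apart, since bounded balls may only approach it.
  rcases hc.eq_or_lt with rfl | hlt
  · exact ⟨S, subset_rfl, hS, rfl⟩
  have hcont := continuous_integral_inter_closedBall hd hp hS
  have hmeas : ∀ t : ℝ, MeasurableSet (S ∩ Metric.closedBall (0 : Loc d) t) := fun t =>
    hS.inter Metric.isClosed_closedBall.measurableSet
  have hmono : Monotone fun t : ℝ => S ∩ Metric.closedBall (0 : Loc d) t := fun s t hst =>
    Set.inter_subset_inter_right _ (Metric.closedBall_subset_closedBall hst)
  have hU : ⋃ t : ℝ, S ∩ Metric.closedBall (0 : Loc d) t = S := by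
    ext x
    simp only [Set.mem_iUnion, Set.mem_inter_iff, mem_closedBall_zero_iff]
    exact ⟨fun ⟨_, hx, _⟩ => hx, fun hx => ⟨‖x‖, hx, le_rfl⟩⟩
  have hlim := tendsto_setIntegral_of_monotone hmeas hmono (hp.integrableOn (μ := volume))
  rw [hU] at hlim
  obtain ⟨t₁, ht₁, hct₁⟩ :=
    ((Filter.eventually_ge_atTop (-1 : ℝ)).and (hlim.eventually_const_lt hlt)).exists
  -- A negative radius gives the empty ball, the lower end for the intermediate value theorem.
  have h0 : ∫ x in S ∩ Metric.closedBall (0 : Loc d) (-1), p x = 0 := by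
    rw [Metric.closedBall_eq_empty.2 (by norm_num), Set.inter_empty, setIntegral_empty]
  obtain ⟨t, -, ht⟩ := intermediate_value_Icc ht₁ hcont.continuousOn
    (show c ∈ Set.Icc _ _ from ⟨h0.trans_le hc0, hct₁.le⟩)
  exact ⟨_, Set.inter_subset_left, hmeas t, ht⟩

/-- Each piece is carved out of what the earlier ones leave. Requiring only `≤` for the total mass
lets the induction pass to the remainder. -/
lemma exists_disjoint_integral_eq (hd : 0 < d) {p : Loc d → ℝ} (hp : Integrable p)
    {ι : Type*} [DecidableEq ι] (s : Finset ι) (u : ι → ℝ) (hu : ∀ i ∈ s, 0 ≤ u i)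
    {S : Set (Loc d)} (hS : MeasurableSet S) (hsum : ∑ i ∈ s, u i ≤ ∫ x in S, p x) :
    ∃ T : ι → Set (Loc d), (∀ i ∈ s, MeasurableSet (T i) ∧ T i ⊆ S ∧ ∫ x in T i, p x = u i) ∧
      (s : Set ι).PairwiseDisjoint T := by
  induction s using Finset.induction_on generalizing S with
  | empty => exact ⟨fun _ => ∅, by simp, by simp⟩
  | insert a s ha ih =>
    rw [Finset.sum_insert ha] at hsum
    have hs0 : ∀ i ∈ s, 0 ≤ u i := fun i hi => hu i (Finset.mem_insert_of_mem hi)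
    have hle : u a ≤ ∫ x in S, p x := by linarith [Finset.sum_nonneg hs0]
    obtain ⟨R, hRS, hR, hRu⟩ :=
      exists_subset_integral_eq hd hp hS (hu a (Finset.mem_insert_self a s)) hle
    have hdiff : ∑ i ∈ s, u i ≤ ∫ x in S \ R, p x := by
      rw [setIntegral_sdiff hR hp.integrableOn hRS, hRu]; linarith
    obtain ⟨T, hT, hdis⟩ := ih hs0 (hS.diff hR) hdiff
    have hne : ∀ i ∈ s, i ≠ a := fun i hi hia => ha (hia ▸ hi)
    refine ⟨Function.update T a R, fun i hi => ?_, ?_⟩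
    · rcases Finset.mem_insert.1 hi with rfl | hi
      · rw [Function.update_self]; exact ⟨hR, hRS, hRu⟩
      · rw [Function.update_of_ne (hne i hi)]
        exact ⟨(hT i hi).1, (hT i hi).2.1.trans Set.sdiff_subset, (hT i hi).2.2⟩
    · rw [Finset.coe_insert, Set.pairwiseDisjoint_insert_of_notMem (by simpa using ha)]
      refine ⟨fun i hi j hj hij => ?_, fun j hj => ?_⟩
      · simpa [Function.onFun, Function.update_of_ne (hne i hi), Function.update_of_ne (hne j hj)]
          using hdis hi hj hij
      · rw [Function.update_self, Function.update_of_ne (hne j hj)]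
        exact (Set.disjoint_sdiff_left.mono_left (hT j hj).2.1).symm

lemma exists_queries_integral_cell_eq (hd : 0 < d) {p : Loc d → ℝ} (hp : IsDensity p)
    {u : (Fin M → Bool) → ℝ} (hu : u ∈ stdSimplex ℝ (Fin M → Bool)) :
    ∃ A : Queries d M, (∀ m, MeasurableSet (A m)) ∧ ∀ i, ∫ x in cell A i, p x = u i := by
  obtain ⟨T, hT, hdis⟩ := exists_disjoint_integral_eq hd hp.integrable Finset.univ u
    (fun i _ => hu.1 i) MeasurableSet.univ
    (by rw [setIntegral_univ, hp.integral_eq_one, hu.2])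
  -- Player `m` is asked about the union of the pieces whose label has `m`-th bit one, so that `T i`
  -- falls in the cell with index `i`.
  let A : Queries d M := fun m => ⋃ i, ⋃ _ : i m = true, T i
  have hA : ∀ m, MeasurableSet (A m) := fun m =>
    MeasurableSet.iUnion fun i => MeasurableSet.iUnion fun _ => (hT i (Finset.mem_univ i)).1
  have hsub : ∀ i, T i ⊆ cell A i := by
    intro i x hx
    rw [mem_cell_iff]
    funext m
    have hmem : x ∈ A m ↔ i m = true := by
      simp only [A, Set.mem_iUnion, exists_prop]
      refine ⟨fun ⟨j, hj, hxj⟩ => ?_, fun hi => ⟨i, hi, hx⟩⟩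
      have hij : j = i := by
        by_contra hne
        exact Set.disjoint_left.1 (hdis (by simp) (by simp) hne) hxj hx
      rwa [← hij]
    simp [pattern, hmem]
  -- The pieces need not cover the space, so a cell may exceed its piece; but both families of
  -- masses sum to one, which forces equality.
  have hle : ∀ i ∈ Finset.univ, u i ≤ ∫ x in cell A i, p x := fun i hi => by
    rw [← (hT i hi).2.2]
    exact setIntegral_mono_set hp.integrable.integrableOn
      (Filter.Eventually.of_forall hp.nonneg) (hsub i).eventuallyLE
  have hsum : ∑ i, u i = ∑ i, ∫ x in cell A i, p x := by
    rw [sum_integral_cell hA hp.integrable, hp.integral_eq_one, hu.2]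
  exact ⟨A, hA, fun i =>
    ((Finset.sum_eq_sum_iff_of_le hle).1 hsum i (Finset.mem_univ i)).symm⟩

/-! ### Memoryless channels -/

/-- The mutual information between the input and the output of a channel with conditional
probabilities `g` and input distribution `u`. -/
def mutualInfo {α β : Type*} [Fintype α] [Fintype β] (g : α → β → ℝ) (u : α → ℝ) : ℝ :=
  shannonEntropy (fun y => ∑ i, g i y * u i) - ∑ i, shannonEntropy (g i) * u i

/-- Continuity up to the boundary of the simplex holds because `t log t` is continuous at zero; the
second term is linear. -/
lemma continuous_mutualInfo {α β : Type*} [Fintype α] [Fintype β] (g : α → β → ℝ) :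
    Continuous (mutualInfo g) := by
  unfold mutualInfo shannonEntropy
  refine .sub (.neg (continuous_finsetSum _ fun y _ => ?_)) (by fun_prop)
  exact Real.continuous_mul_log.comp (by fun_prop : Continuous fun u : α → ℝ => ∑ i, g i y * u i)

lemma exists_isMaxOn_mutualInfo {α β : Type*} [Fintype α] [Nonempty α] [Fintype β]
    (g : α → β → ℝ) : ∃ u ∈ stdSimplex ℝ α, IsMaxOn (mutualInfo g) (stdSimplex ℝ α) u := by
  classical
  exact (isCompact_stdSimplex ℝ α).exists_isMaxOn
    ⟨_, single_mem_stdSimplex ℝ (Classical.arbitrary α)⟩ (continuous_mutualInfo g).continuousOn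

lemma jointPMF_eq_of_isMemoryless {f : Channel d M} (hf : IsMemoryless f)
    (h h' : History d M) (A A' : Queries d M) : jointPMF f h A = jointPMF f h' A' := by
  funext i y
  exact Finset.prod_congr rfl fun m _ => by rw [hf h h' m (A m) (A' m)]

lemma integral_cell_mem_stdSimplex {p : Loc d → ℝ} (hp : IsDensity p) {A : Queries d M}
    (hA : ∀ m, MeasurableSet (A m)) :
    (fun i => ∫ x in cell A i, p x) ∈ stdSimplex ℝ (Fin M → Bool) :=
  ⟨hp.integral_cell_nonneg A, by rw [sum_integral_cell hA hp.integrable, hp.integral_eq_one]⟩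

theorem exists_gain_max_of_isMemoryless (hd : 0 < d) {f : Channel d M} (hf : IsMemoryless f) :
    ∃ G : ℝ, ∀ (h : History d M) (p : Loc d → ℝ), IsDensity p →
      (∀ A : Queries d M, (∀ m, MeasurableSet (A m)) → gain f h p A ≤ G) ∧
      ∃ A : Queries d M, (∀ m, MeasurableSet (A m)) ∧ gain f h p A = G := by
  -- Without memory, any history and queries give the same joint channel; the empty ones serve as
  -- reference.
  set g := jointPMF f [] fun _ => ∅
  obtain ⟨u, hu, hmax⟩ := exists_isMaxOn_mutualInfo g
  refine ⟨mutualInfo g u, fun h p hp => ?_⟩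
  have hgain : ∀ A, gain f h p A = mutualInfo g fun i => ∫ x in cell A i, p x := fun A => by
    rw [gain, jointPMF_eq_of_isMemoryless hf h [] A fun _ => ∅, mutualInfo]
  refine ⟨fun A hA => (hgain A).trans_le (hmax (integral_cell_mem_stdSimplex hp hA)), ?_⟩
  obtain ⟨A, hA, hAu⟩ := exists_queries_integral_cell_eq hd hp hu
  exact ⟨A, hA, by rw [hgain, funext hAu]⟩

end TwentyQuestions

end

theorem theorem1 {d M : ℕ} (hd : 0 < d) (N : ℕ)
    (f : Channel d M) (hf : IsChannel f) :
    -- general conditional channels and general classes of measurable query regions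
    (∀ Q : ℕ → Fin M → Set (Set (Loc d)),
      (∀ n m, (Q n m).Nonempty) → (∀ n m, ∀ A ∈ Q n m, MeasurableSet A) →
      ∀ (h : History d M) (p : Loc d → ℝ),
        IsDensity p →
        -- the expected one-step entropy loss, and its supremum over the queries
        (∀ A : Admissible Q h.length,
          diffEntropy p - expectedNextEntropy f h p A.1
            = gain f h p A.1) ∧
        IsLUB (Set.range fun A : Admissible Q h.length =>
            diffEntropy p - expectedNextEntropy f h p A.1)
          (maxGain Q f h p) ∧
        -- if the maximal loss is the same number `G` at all the remaining steps, then it gives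
        -- the value function, and the optimal policies are the greedy ones
        ∀ G : ℝ, h.length ≤ N →
          (∀ (ζ : Policy Q) (ys : List (Responses M)),
            h.length + ys.length < N → 0 < pathProb f ζ h p ys →
            maxGain Q f (run ζ h ys)
              (posterior f ζ h p ys) = G) →
          IsGLB (Set.range fun ζ : Policy Q =>
              expectedFinalEntropy f N h p ζ) (value Q f N h p) ∧
          value Q f N h p
            = diffEntropy p - ((N : ℝ) - h.length) * G ∧
          ∀ ζ : Policy Q,
            IsOptimal f N h p ζ ↔ IsGreedy f N h p ζ) ∧
    -- memoryless channels, all measurable query regions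
    (IsMemoryless f →
      ∀ Q : ℕ → Fin M → Set (Set (Loc d)),
        (∀ n m, Q n m = {A | MeasurableSet A}) →
        ∃ G : ℝ, ∀ (h : History d M) (p : Loc d → ℝ),
          IsDensity p →
          maxGain Q f h p = G ∧
          (∃ A : Admissible Q h.length, gain f h p A.1 = G) ∧
          (h.length ≤ N →
            IsGLB (Set.range fun ζ : Policy Q =>
                expectedFinalEntropy f N h p ζ)
              (value Q f N h p) ∧
            value Q f N h p
              = diffEntropy p - ((N : ℝ) - h.length) * G ∧
            (∃ ζ : Policy Q, IsOptimal f N h p ζ) ∧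
            ∀ ζ : Policy Q,
              IsOptimal f N h p ζ ↔ IsGreedy f N h p ζ)) := by
  refine ⟨fun Q hne hQ h p hp => ?_, fun hmem Q hQ => ?_⟩
  · have hloss : ∀ A : Admissible Q h.length,
        diffEntropy p - expectedNextEntropy f h p A.1 = gain f h p A.1 := fun A =>
      diffEntropy_sub_expectedNextEntropy hf h hp fun m => hQ _ m _ (A.2 m)
    refine ⟨hloss, ?_, fun G hN hG => value_of_constant_maxGain hf hne hQ hp hN hG⟩
    rw [funext hloss]
    exact isLUB_maxGain hne hf h hp
  · have hne : ∀ n m, (Q n m).Nonempty := fun n m => by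
      rw [hQ]; exact ⟨∅, MeasurableSet.empty (α := Loc d)⟩
    have hQm : ∀ n m, ∀ A ∈ Q n m, MeasurableSet A := fun n m A hA => by
      rw [hQ] at hA; exact hA
    obtain ⟨G, hG⟩ := exists_gain_max_of_isMemoryless hd hmem
    have hatt : ∀ (h : History d M) (p : Loc d → ℝ), IsDensity p →
        ∃ A : Admissible Q h.length, gain f h p A.1 = G := fun h p hp => by
      obtain ⟨A, hA, hAG⟩ := (hG h p hp).2
      exact ⟨⟨A, fun m => by rw [hQ]; exact hA m⟩, hAG⟩
    have hmax : ∀ (h : History d M) (p : Loc d → ℝ), IsDensity p → maxGain Q f h p = G := by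
      intro h p hp
      obtain ⟨A, hA⟩ := hatt h p hp
      refine (isLUB_maxGain hne hf h hp).unique ⟨?_, fun b hb => hA ▸ hb ⟨A, rfl⟩⟩
      rintro _ ⟨A, rfl⟩
      exact (hG h p hp).1 A.1 fun m => hQm _ m _ (A.2 m)
    refine ⟨G, fun h p hp => ⟨hmax h p hp, hatt h p hp, fun hN => ?_⟩⟩
    obtain ⟨hglb, hval, hopt⟩ := value_of_constant_maxGain hf hne hQm hp hN
      fun ζ ys _ hpos => hmax _ _ (isDensity_posterior hf hQm ζ h hp hpos)
    obtain ⟨ζ, hζ⟩ := exists_isGreedy (N := N) (h := h) hf hne hQm hp fun h' p' hp' => by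
      rw [hmax h' p' hp']; exact hatt h' p' hp'
    exact ⟨hglb, hval, ⟨ζ, (hopt ζ).2 hζ⟩, hopt⟩
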